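/- A \emph{divergence} $\mathbb{D}$ is a function that assigns to every pair of states $\rho,\sigma$ (density operators) on the same finite-dimensional complex Hilbert space a value $\mathbb{D}(\rho\|\sigma)\in\mathbb{R}\cup\{+\infty\}$ and satisfies the data-processing inequality $\mathbb{D}(\Lambda(\rho)\|\Lambda(\sigma))\le\mathbb{D}(\rho\|\sigma)$ for every quantum channel (completely positive trace-preserving linear map) $\Lambda$. Write $\mathcal{D}(\mathcal{K})$ for the set of states on $\mathcal{K}$. The divergence $\mathbb{D}$ is \emph{weakly quasi-concave} in dimension $d$ if there is a real polynomial $P_d$ in two variables such that, for every Hilbert space $\mathcal{H}$ with $\dim\mathcal{H}=d$, every $n\ge 1$, every finite ensemble $\{(p_i,\rho_i)\}_{i=1}^N$ of states on $\mathcal{H}^{\otimes n}$ and every $\sigma\in\mathcal{D}(\mathcal{H}^{\otimes n})$, one has $P_d(N,s_\sigma)>0$ and $$\mathbb{D}\Big(\sum_{i=1}^N p_i\rho_i\,\Big\|\,\sigma\Big)\ \ge\ \min_{1\le i\le N}\mathbb{D}(\rho_i\|\sigma)-\log P_d(N,s_\sigma),$$ where $s_\sigma=|\mathrm{spec}(\sigma)|$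 is the number of distinct eigenvalues of $\sigma$. \textbf{Lemma.} Let $\mathbb{D}$ be a divergence that is weakly quasi-concave in dimension $d$. Then there is a real polynomial $Q_d$ in one variable, with $Q_d(n)>0$ for all integers $n\ge1$, such that for every Hilbert space $\mathcal{H}$ with $\dim\mathcal{H}=d$, every $n\ge 1$, every Borel probability measure $\nu$ on $\mathcal{D}(\mathcal{H})$ and every permutationally symmetric state $\sigma^{(n)}\in\mathcal{D}(\mathcal{H}^{\otimes n})$ (that is, $U_\pi\sigma^{(n)}U_\pi^\dagger=\sigma^{(n)}$ for every permutation $\pi\in S_n$ of the tensor factors), $$\mathbb{D}\Big(\mathbb{E}_{\rho\sim\nu}\,\rho^{\otimes n}\,\Big\|\,\sigma^{(n)}\Big)\ \ge\ \inf_{\rho\in\mathrm{supp}(\nu)}\mathbb{D}\big(\rho^{\otimes n}\,\big\|\,\sigma^{(n)}\big)-\log Q_d(n).$$ -/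

import Mathlib

open scoped Matrix ComplexOrder

universe u

namespace Quantum

/-- States (density matrices) on the Hilbert space `ℂ^ι`: positive semidefinite, of trace one. -/
abbrev State (ι : Type u) [Fintype ι] : Type u :=
  {ρ : Matrix ι ι ℂ // ρ.PosSemidef ∧ ρ.trace = 1}

/-- States carry the Borel σ-algebra of the topology inherited from matrices. -/
noncomputable instance State.instMeasurableSpace (ι : Type u) [Fintype ι] : MeasurableSpace (State ι) :=
  borel (State ι)

instance State.instBorelSpace (ι : Type u) [Fintype ι] : BorelSpace (State ι) := ⟨rfl⟩

/-! ### Quantum channels -/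

section Channels

variable {ι κ : Type u} [Fintype ι] [Fintype κ]

/-- The map `id_k ⊗ Λ` on operators on `ℂ^k ⊗ ℂ^ι`, acting by `Λ` on each of the `k × k` blocks. -/
def ampliation (k : ℕ) (Λ : Matrix ι ι ℂ →ₗ[ℂ] Matrix κ κ ℂ)
    (M : Matrix (Fin k × ι) (Fin k × ι) ℂ) : Matrix (Fin k × κ) (Fin k × κ) ℂ :=
  Matrix.of fun x y => Λ (Matrix.of fun i j => M (x.1, i) (y.1, j)) x.2 y.2

/-- A quantum channel: a completely positive, trace-preserving linear map. -/
structure IsChannel (Λ : Matrix ι ι ℂ →ₗ[ℂ] Matrix κ κ ℂ) : Prop where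
  completelyPositive : ∀ (k : ℕ) (M : Matrix (Fin k × ι) (Fin k × ι) ℂ),
    M.PosSemidef → (ampliation k Λ M).PosSemidef
  tracePreserving : ∀ X : Matrix ι ι ℂ, (Λ X).trace = X.trace

theorem IsChannel.posSemidef {Λ : Matrix ι ι ℂ →ₗ[ℂ] Matrix κ κ ℂ} (hΛ : IsChannel Λ)
    {X : Matrix ι ι ℂ} (hX : X.PosSemidef) : (Λ X).PosSemidef :=
  (hΛ.completelyPositive 1 _ (hX.submatrix (Prod.snd : Fin 1 × ι → ι))).submatrix
    (fun i : κ => ((0 : Fin 1), i))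

/-- The image of a state under a channel. -/
def IsChannel.mapState {Λ : Matrix ι ι ℂ →ₗ[ℂ] Matrix κ κ ℂ} (hΛ : IsChannel Λ) (ρ : State ι) :
    State κ :=
  ⟨Λ ρ.1, hΛ.posSemidef ρ.2.1, (hΛ.tracePreserving ρ.1).trans ρ.2.2⟩

end Channels

/-- A divergence: a function on pairs of states of every finite-dimensional Hilbert space, with
values in `ℝ ∪ {+∞}`, that satisfies the data-processing inequality. -/
structure Divergence where
  val : ∀ {ι : Type u} [Fintype ι], State ι → State ι → EReal
  ne_bot : ∀ {ι : Type u} [Fintype ι] (ρ σ : State ι), val ρ σ ≠ ⊥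
  dataProcessing : ∀ {ι κ : Type u} [Fintype ι] [Fintype κ]
    (Λ : Matrix ι ι ℂ →ₗ[ℂ] Matrix κ κ ℂ) (hΛ : IsChannel Λ) (ρ σ : State ι),
    val (hΛ.mapState ρ) (hΛ.mapState σ) ≤ val ρ σ

/-! ### Mixtures, tensor powers, averages -/

section Constructions

variable {ι : Type u} [Fintype ι]

/-- The mixture `∑ i, p i • ρ i` of a finite ensemble of states. -/
def mixture {N : ℕ} (p : Fin N → ℝ) (hp : ∀ i, 0 ≤ p i) (hp1 : ∑ i, p i = 1)
    (ρ : Fin N → State ι) : State ι :=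
  ⟨∑ i, (p i : ℂ) • (ρ i).1,
    Matrix.posSemidef_sum _ fun i _ => (ρ i).2.1.smul (by exact_mod_cast hp i), by
      rw [Matrix.trace_sum]
      simp only [Matrix.trace_smul, (ρ _).2.2, smul_eq_mul, mul_one]
      exact_mod_cast hp1⟩

/-- The tensor power `A^{⊗n}`; the space `(ℂ^ι)^{⊗n}` is identified with `ℂ^(Fin n → ι)`. -/
def tensorPow (n : ℕ) (A : Matrix ι ι ℂ) : Matrix (Fin n → ι) (Fin n → ι) ℂ :=
  Matrix.of fun x y => ∏ k, A (x k) (y k)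

theorem tensorPow_conjTranspose_mul (n : ℕ) (B : Matrix ι ι ℂ) :
    tensorPow n (Bᴴ * B) = (tensorPow n B)ᴴ * tensorPow n B := by
  classical
  ext x y
  simp only [tensorPow, Matrix.of_apply, Matrix.mul_apply, Matrix.conjTranspose_apply, star_prod,
    ← Finset.prod_mul_distrib]
  rw [Finset.prod_univ_sum, Fintype.piFinset_univ]

theorem trace_tensorPow (n : ℕ) (A : Matrix ι ι ℂ) : (tensorPow n A).trace = A.trace ^ n := by
  classical
  have h := Finset.prod_univ_sum (fun _ : Fin n => (Finset.univ : Finset ι)) (fun _ i => A i i)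
  simp only [Finset.prod_const, Finset.card_univ, Fintype.card_fin, Fintype.piFinset_univ] at h
  simp only [Matrix.trace, Matrix.diag_apply, tensorPow, Matrix.of_apply]
  exact h.symm

open scoped MatrixOrder in
theorem exists_conjTranspose_mul_self {A : Matrix ι ι ℂ} (hA : A.PosSemidef) :
    ∃ B : Matrix ι ι ℂ, A = Bᴴ * B := by
  classical
  exact CStarAlgebra.nonneg_iff_eq_star_mul_self.mp hA.nonneg

/-- The `n`-fold i.i.d. state `ρ^{⊗n}`. -/
def State.tensorPow (n : ℕ) (ρ : State ι) : State (Fin n → ι) :=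
  ⟨Quantum.tensorPow n ρ.1, by
      obtain ⟨B, hB⟩ := exists_conjTranspose_mul_self ρ.2.1
      rw [hB, tensorPow_conjTranspose_mul]
      exact Matrix.posSemidef_conjTranspose_mul_self _, by
      rw [trace_tensorPow, ρ.2.2, one_pow]⟩

theorem State.norm_apply_le_one (ρ : State ι) (i j : ι) : ‖ρ.1 i j‖ ≤ 1 := by
  obtain ⟨B, hB⟩ := exists_conjTranspose_mul_self ρ.2.1
  have hd : ∑ l, ∑ k, ‖B k l‖ ^ 2 = 1 := by
    have h := ρ.2.2
    rw [hB] at h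
    simp only [Matrix.trace, Matrix.diag_apply, Matrix.mul_apply, Matrix.conjTranspose_apply,
      RCLike.star_def, Complex.conj_mul'] at h
    exact_mod_cast h
  have hle : ∀ l, ∑ k, ‖B k l‖ ^ 2 ≤ 1 := fun l => hd ▸
    Finset.single_le_sum (f := fun l => ∑ k, ‖B k l‖ ^ 2)
      (fun _ _ => Finset.sum_nonneg fun _ _ => by positivity) (Finset.mem_univ l)
  rw [hB, Matrix.mul_apply]
  calc ‖∑ k, Bᴴ i k * B k j‖ ≤ ∑ k, ‖Bᴴ i k * B k j‖ := norm_sum_le _ _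
    _ ≤ ∑ k, (‖B k i‖ ^ 2 + ‖B k j‖ ^ 2) / 2 := by
      refine Finset.sum_le_sum fun k _ => ?_
      rw [norm_mul, Matrix.conjTranspose_apply, norm_star]
      nlinarith [sq_nonneg (‖B k i‖ - ‖B k j‖)]
    _ ≤ 1 := by
      rw [← Finset.sum_div, Finset.sum_add_distrib]
      linarith [hle i, hle j]

theorem State.integrable_tensorPow_apply (n : ℕ) (ν : MeasureTheory.Measure (State ι))
    [MeasureTheory.IsProbabilityMeasure ν] (x y : Fin n → ι) :
    MeasureTheory.Integrable (fun ρ : State ι => (ρ.tensorPow n).1 x y) ν := by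
  have hc : Continuous fun ρ : State ι => (ρ.tensorPow n).1 x y := by
    change Continuous fun ρ : State ι => ∏ k, ρ.1 (x k) (y k)
    exact continuous_finsetProd _ fun k _ => continuous_subtype_val.matrix_elem _ _
  exact MeasureTheory.Integrable.of_bound hc.measurable.aestronglyMeasurable 1
    (Filter.Eventually.of_forall fun ρ => (ρ.tensorPow n).norm_apply_le_one x y)

/-- The average `𝔼_{ρ ∼ ν} ρ^{⊗n}`, the integral being taken entrywise. -/
noncomputable def averageTensorPow (n : ℕ) (ν : MeasureTheory.Measure (State ι))
    [MeasureTheory.IsProbabilityMeasure ν] : State (Fin n → ι) :=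
  ⟨Matrix.of fun x y => ∫ ρ, (ρ.tensorPow n).1 x y ∂ν, by
    rw [Matrix.posSemidef_iff_dotProduct_mulVec]
    refine ⟨?_, fun v => ?_⟩
    · ext x y
      simp only [Matrix.conjTranspose_apply, Matrix.of_apply, RCLike.star_def]
      rw [← integral_conj]
      congr 1
      ext ρ
      exact (ρ.tensorPow n).2.1.isHermitian.apply x y
    · have h : star v ⬝ᵥ ((Matrix.of fun x y => ∫ ρ, (ρ.tensorPow n).1 x y ∂ν) *ᵥ v)
          = ∫ ρ, star v ⬝ᵥ ((ρ.tensorPow n).1 *ᵥ v) ∂ν := by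
        simp only [dotProduct, Matrix.mulVec, Matrix.of_apply]
        rw [MeasureTheory.integral_finsetSum]
        · refine Finset.sum_congr rfl fun x _ => ?_
          rw [MeasureTheory.integral_const_mul, MeasureTheory.integral_finsetSum]
          · simp only [MeasureTheory.integral_mul_const]
          · exact fun y _ => (State.integrable_tensorPow_apply n ν x y).mul_const _
        · exact fun x _ => (MeasureTheory.integrable_finsetSum _ fun y _ =>
            (State.integrable_tensorPow_apply n ν x y).mul_const _).const_mul _
      rw [h]
      exact MeasureTheory.integral_nonneg fun ρ => (ρ.tensorPow n).2.1.dotProduct_mulVec_nonneg v,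
   by
    simp only [Matrix.trace, Matrix.diag_apply, Matrix.of_apply]
    rw [← MeasureTheory.integral_finsetSum _
      fun x _ => State.integrable_tensorPow_apply n ν x x]
    have h : ∀ ρ : State ι, ∑ x, (ρ.tensorPow n).1 x x = 1 := fun ρ => (ρ.tensorPow n).2.2
    simp [h]⟩

/-- The unitary on `(ℂ^ι)^{⊗n}` that permutes the tensor factors, `|y⟩ ↦ |y ∘ π⟩`. -/
noncomputable def permOp (ι : Type u) {n : ℕ} (π : Equiv.Perm (Fin n)) :
    Matrix (Fin n → ι) (Fin n → ι) ℂ :=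
  open Classical in Matrix.of fun x y => if x = y ∘ π then 1 else 0

/-- `σ` is permutationally symmetric: invariant under permutations of the tensor factors. -/
def State.IsPermSymmetric {n : ℕ} (σ : State (Fin n → ι)) : Prop :=
  ∀ π : Equiv.Perm (Fin n), permOp ι π * σ.1 * (permOp ι π)ᴴ = σ.1

/-- The number of distinct eigenvalues of a state. -/
noncomputable def State.specCard (σ : State ι) : ℕ :=
  open Classical in (spectrum ℂ σ.1).ncard

end Constructions

/-- Weak quasi-concavity in dimension `d`: for some polynomial `P` in two variables, every finite
ensemble of `N` states on `H^{⊗n}`, with `dim H = d` and `n ≥ 1`, satisfies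
`D(∑ i, p i • ρ i ‖ σ) ≥ min_i D(ρ i ‖ σ) - log P(N, |spec σ|)`. -/
def Divergence.WeaklyQuasiConcave (D : Divergence.{u}) (d : ℕ) : Prop :=
  ∃ P : MvPolynomial (Fin 2) ℝ, ∀ (ι : Type u) [Fintype ι], Fintype.card ι = d →
    ∀ n : ℕ, 1 ≤ n → ∀ (N : ℕ) (p : Fin N → ℝ) (hp : ∀ i, 0 ≤ p i) (hp1 : ∑ i, p i = 1)
      (ρ : Fin N → State (Fin n → ι)) (σ : State (Fin n → ι)),
      0 < MvPolynomial.eval ![(N : ℝ), (σ.specCard : ℝ)] P ∧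
      (⨅ i, D.val (ρ i) σ) -
          ((Real.log (MvPolynomial.eval ![(N : ℝ), (σ.specCard : ℝ)] P) : ℝ) : EReal)
        ≤ D.val (mixture p hp hp1 ρ) σ

end Quantum

/-! An entry of `ρ^{⊗n}` at `(x, y)` is a product of entries of `ρ`, so it depends only on the type
of the sequence of pairs `(x k, y k)`. There are at most `(n+1)^(d²)` types, hence all i.i.d. states
sit in a real space of dimension `2(n+1)^(d²)`. The average over `ν` lies in the convex hull of the
compact set of `ρ^{⊗n}` with `ρ` in the support, and Carathéodory turns it into an exact mixture of
`N = 2(n+1)^(d²) + 1` of them. Exactness matters: no continuity of the divergence is assumed. The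
same count bounds the dimension of the algebra of permutation-invariant operators, which contains
`σ`, and so the number of eigenvalues of `σ`. Weak quasi-concavity then costs only the logarithm of
a polynomial in `n`. -/

namespace Quantum

/-! ### Convex hulls in finite dimension -/

section ConvexHull

variable {E : Type*} [AddCommGroup E] [Module ℝ E] [FiniteDimensional ℝ E]

/-- Carathéodory's theorem with a fixed number of points. -/
theorem exists_stdSimplex_sum_of_mem_convexHull {s : Set E} {x : E} (hx : x ∈ convexHull ℝ s) :
    ∃ w ∈ stdSimplex ℝ (Fin (Module.finrank ℝ E + 1)),
      ∃ z : Fin (Module.finrank ℝ E + 1) → E, (∀ i, z i ∈ s) ∧ ∑ i, w i • z i = x := by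
  classical
  obtain ⟨z₀, hz₀⟩ : s.Nonempty := convexHull_nonempty_iff.mp ⟨x, hx⟩
  obtain ⟨α, _, z, w, hz, hind, hw, hw1, hsum⟩ := eq_pos_convex_span_of_mem_convexHull hx
  have hcard : Fintype.card α ≤ Fintype.card (Fin (Module.finrank ℝ E + 1)) := by
    rw [Fintype.card_fin]
    exact hind.card_le_finrank_succ.trans (Nat.succ_le_succ (Submodule.finrank_le _))
  obtain ⟨e⟩ := Function.Embedding.nonempty_of_card_le hcard
  have hext : ∀ (a : α), Function.extend e w 0 (e a) = w a := fun a => e.injective.extend_apply _ _ _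
  have hzero : ∀ i, i ∉ Set.range e → Function.extend e w 0 i = 0 := fun i hi =>
    Function.extend_apply' _ _ _ fun ⟨a, ha⟩ => hi ⟨a, ha⟩
  -- Unused slots get weight zero and the dummy point `z₀`, which keeps all points in `s`.
  refine ⟨Function.extend e w 0, ⟨fun i => ?_, ?_⟩, Function.extend e z fun _ => z₀, fun i => ?_, ?_⟩
  · by_cases hi : i ∈ Set.range e
    · obtain ⟨a, rfl⟩ := hi
      exact (hext a).symm ▸ (hw a).le
    · exact (hzero i hi).ge
  · rw [← hw1]
    exact (Fintype.sum_of_injective e e.injective _ _ hzero fun a => (hext a).symm).symm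
  · by_cases hi : i ∈ Set.range e
    · obtain ⟨a, rfl⟩ := hi
      rw [e.injective.extend_apply]
      exact hz ⟨a, rfl⟩
    · rwa [Function.extend_apply' _ _ _ fun ⟨a, ha⟩ => hi ⟨a, ha⟩]
  · rw [← hsum]
    refine (Fintype.sum_of_injective e e.injective _ _ (fun i hi => ?_) fun a => ?_).symm
    · rw [hzero i hi, zero_smul]
    · rw [hext, e.injective.extend_apply]

/-- In finite dimension the convex hull of a compact set is compact. -/
theorem isCompact_convexHull_of_isCompact [TopologicalSpace E] [IsTopologicalAddGroup E]
    [ContinuousSMul ℝ E] {s : Set E} (hs : IsCompact s) : IsCompact (convexHull ℝ s) := by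
  -- The fixed number of points makes the hull a continuous image of one compact product.
  have himage : convexHull ℝ s =
      (fun q : (Fin (Module.finrank ℝ E + 1) → ℝ) × (Fin (Module.finrank ℝ E + 1) → E) =>
        ∑ i, q.1 i • q.2 i) '' (stdSimplex ℝ _ ×ˢ Set.univ.pi fun _ => s) := by
    refine Set.Subset.antisymm (fun x hx => ?_) ?_
    · obtain ⟨w, hw, z, hz, hsum⟩ := exists_stdSimplex_sum_of_mem_convexHull hx
      exact ⟨(w, z), ⟨hw, fun i _ => hz i⟩, hsum⟩
    · rintro _ ⟨⟨w, z⟩, ⟨hw, hz⟩, rfl⟩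
      exact (convex_convexHull ℝ s).sum_mem (fun i _ => hw.1 i) hw.2
        fun i _ => subset_convexHull ℝ s (hz i trivial)
  rw [himage]
  exact ((isCompact_stdSimplex ℝ _).prod (isCompact_univ_pi fun _ => hs)).image (by fun_prop)

end ConvexHull

/-! ### Types of sequences -/

section Types

/-- The type of a sequence: how often it takes each value. -/
def typeCount {α : Type*} [DecidableEq α] {n : ℕ} (z : Fin n → α) (a : α) : Fin (n + 1) :=
  ⟨Fintype.card {k // z k = a},
    Nat.lt_succ_of_le ((Fintype.card_subtype_le _).trans (Fintype.card_fin n).le)⟩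

/-- Equal counts give bijections between corresponding fibres, which glue to a permutation. -/
theorem exists_comp_perm_of_typeCount_eq {α : Type*} [DecidableEq α] {n : ℕ} {z z' : Fin n → α}
    (h : typeCount z = typeCount z') : ∃ π : Equiv.Perm (Fin n), z = z' ∘ π := by
  have hcard : ∀ a, Fintype.card {k // z k = a} = Fintype.card {k // z' k = a} := fun a =>
    congrArg Fin.val (congrFun h a)
  refine ⟨((Equiv.sigmaFiberEquiv z).symm.trans
    (Equiv.sigmaCongrRight fun a => Fintype.equivOfCardEq (hcard a))).trans
      (Equiv.sigmaFiberEquiv z'), funext fun k => ?_⟩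
  exact (Fintype.equivOfCardEq (hcard (z k)) ⟨k, rfl⟩).2.symm

theorem prod_comp_eq_prod_pow_typeCount {α M : Type*} [Fintype α] [DecidableEq α] [CommMonoid M]
    {n : ℕ} (g : α → M) (z : Fin n → α) :
    ∏ k, g (z k) = ∏ a, g a ^ (typeCount z a : ℕ) := by
  rw [← Finset.prod_fiberwise Finset.univ z]
  refine Finset.prod_congr rfl fun a _ => ?_
  rw [Finset.prod_congr rfl fun k hk => by rw [(Finset.mem_filter.mp hk).2], Finset.prod_const,
    ← Fintype.card_subtype]
  rfl

end Types

/-! ### The spectrum of a permutationally symmetric state -/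

section Spectrum

/-- An element of a finite-dimensional subalgebra has at most as many points in its spectrum as the
subalgebra has dimensions. -/
theorem ncard_spectrum_le_finrank {K A : Type*} [Field K] [Ring A] [Algebra K A] [Nontrivial A]
    (S : Subalgebra K A) [FiniteDimensional K S] {a : A} (ha : a ∈ S) :
    (spectrum K a).ncard ≤ Module.finrank K S := by
  classical
  -- Cayley–Hamilton for left multiplication by `a` on `S`, evaluated at `1`.
  obtain ⟨q, hmonic, hdeg, hqS⟩ : ∃ q : Polynomial K, q.Monic ∧ q.natDegree = Module.finrank K S ∧
      Polynomial.aeval (⟨a, ha⟩ : S) q = 0 := by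
    refine ⟨_, (Algebra.lmul K S ⟨a, ha⟩).charpoly_monic, LinearMap.charpoly_natDegree _, ?_⟩
    have h := LinearMap.aeval_self_charpoly (Algebra.lmul K S ⟨a, ha⟩)
    rw [Polynomial.aeval_algHom_apply] at h
    simpa using congrArg (fun f : Module.End K S => f 1) h
  have hqA : Polynomial.aeval a q = 0 := by
    have := congrArg S.val hqS
    rwa [← Polynomial.aeval_algHom_apply, map_zero] at this
  have hsub : spectrum K a ⊆ q.roots.toFinset := fun μ hμ => by
    have h := spectrum.subset_polynomial_aeval a q ⟨μ, hμ, rfl⟩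
    rw [hqA, spectrum.zero_eq, Set.mem_singleton_iff] at h
    simpa [hmonic.ne_zero] using h
  calc (spectrum K a).ncard ≤ (q.roots.toFinset : Set K).ncard :=
        Set.ncard_le_ncard hsub (Finset.finite_toSet _)
    _ ≤ q.roots.card := by
      rw [Set.ncard_coe_finset]
      exact Multiset.toFinset_card_le _
    _ ≤ q.natDegree := q.card_roots'
    _ ≤ Module.finrank K S := hdeg.le

variable (ι : Type u) [Fintype ι] [DecidableEq ι] (n : ℕ)

/-- The algebra of the operators on `(ℂ^ι)^{⊗n}` that commute with permutations of the factors. -/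
def permInvariant : Subalgebra ℂ (Matrix (Fin n → ι) (Fin n → ι) ℂ) where
  carrier := {A | ∀ (π : Equiv.Perm (Fin n)) x y, A (x ∘ π) (y ∘ π) = A x y}
  add_mem' hA hB π x y := by simp only [Matrix.add_apply, hA π x y, hB π x y]
  mul_mem' := fun {A B} hA hB π x y => by
    simp only [Matrix.mul_apply]
    rw [← Equiv.sum_comp (π.symm.arrowCongr (Equiv.refl ι))]
    refine Finset.sum_congr rfl fun z _ => ?_
    have hz : π.symm.arrowCongr (Equiv.refl ι) z = z ∘ π := rfl
    rw [hz, hA, hB]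
  algebraMap_mem' c π x y := by
    simp only [Matrix.algebraMap_matrix_apply, π.surjective.injective_comp_right.eq_iff]

theorem finrank_permInvariant_le :
    Module.finrank ℂ (permInvariant ι n) ≤ (n + 1) ^ Fintype.card ι ^ 2 := by
  classical
  let pair : (Fin n → ι) × (Fin n → ι) → Fin n → ι × ι := fun q k => (q.1 k, q.2 k)
  let T : (Fin n → ι) × (Fin n → ι) → ι × ι → Fin (n + 1) := fun q => typeCount (pair q)
  -- Reads one chosen entry per occurring type; invariance recovers all the others.
  let F : permInvariant ι n →ₗ[ℂ] (Set.range T → ℂ) :=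
    { toFun := fun A c => A.1 c.2.choose.1 c.2.choose.2
      map_add' := fun _ _ => rfl
      map_smul' := fun _ _ => rfl }
  have hF : Function.Injective F := fun A B hAB => by
    refine Subtype.ext (Matrix.ext fun x y => ?_)
    let c : Set.range T := ⟨T (x, y), (x, y), rfl⟩
    obtain ⟨π, hπ⟩ := exists_comp_perm_of_typeCount_eq c.2.choose_spec
    have hx : c.2.choose.1 = x ∘ π := funext fun k => congrArg Prod.fst (congrFun hπ k)
    have hy : c.2.choose.2 = y ∘ π := funext fun k => congrArg Prod.snd (congrFun hπ k)
    have h : A.1 c.2.choose.1 c.2.choose.2 = B.1 c.2.choose.1 c.2.choose.2 := congrFun hAB c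
    rwa [hx, hy, A.2 π x y, B.2 π x y] at h
  calc Module.finrank ℂ (permInvariant ι n) ≤ Module.finrank ℂ (Set.range T → ℂ) :=
        LinearMap.finrank_le_finrank_of_injective hF
    _ = Fintype.card (Set.range T) := Module.finrank_fintype_fun_eq_card ℂ
    _ ≤ Fintype.card (ι × ι → Fin (n + 1)) := Fintype.card_subtype_le _
    _ = (n + 1) ^ Fintype.card ι ^ 2 := by
      rw [Fintype.card_fun, Fintype.card_fin, Fintype.card_prod, sq]

variable {ι n}

theorem State.IsPermSymmetric.mem_permInvariant {σ : State (Fin n → ι)} (hσ : σ.IsPermSymmetric) :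
    σ.1 ∈ permInvariant ι n := fun π x y => by
  have hcomp : ∀ u v : Fin n → ι, u ∘ π = v ∘ π ↔ u = v := fun u v =>
    π.surjective.injective_comp_right.eq_iff
  conv_lhs => rw [← hσ π]
  simp [Matrix.mul_apply, permOp, hcomp]

/-- A permutationally symmetric state has only polynomially many distinct eigenvalues. -/
theorem State.IsPermSymmetric.specCard_le {σ : State (Fin n → ι)} (hσ : σ.IsPermSymmetric) :
    σ.specCard ≤ (n + 1) ^ Fintype.card ι ^ 2 := by
  -- Trace one excludes an empty index set, so the matrix algebra is nontrivial.
  have hne : Nonempty (Fin n → ι) := by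
    by_contra h
    rw [not_nonempty_iff] at h
    simpa using σ.2.2
  unfold State.specCard
  refine le_trans (le_of_eq ?_)
    ((ncard_spectrum_le_finrank _ hσ.mem_permInvariant).trans (finrank_permInvariant_le ι n))
  congr!

end Spectrum

/-! ### Averages of i.i.d. states as short mixtures -/

section Averages

variable {ι : Type u} [Fintype ι]

instance State.instCompactSpace : CompactSpace (State ι) := by
  have hclosed : IsClosed {A : Matrix ι ι ℂ | A.PosSemidef ∧ A.trace = 1} := by
    simp only [Matrix.posSemidef_iff_dotProduct_mulVec, Matrix.IsHermitian, Set.ofPred_and,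
      Set.ofPred_forall]
    refine ((isClosed_eq (by fun_prop) continuous_id).inter
      (isClosed_iInter fun v => isClosed_le continuous_const ?_)).inter
        (isClosed_eq (by fun_prop) continuous_const)
    fun_prop
  have hbounded : IsCompact {A : Matrix ι ι ℂ | ∀ i j, A i j ∈ Metric.closedBall (0 : ℂ) 1} := by
    have h := isCompact_univ_pi fun _ : ι =>
      isCompact_univ_pi fun _ : ι => isCompact_closedBall (0 : ℂ) 1
    simp only [Set.pi, Set.mem_univ, forall_const, Set.mem_ofPred_eq] at h
    exact h
  refine isCompact_iff_compactSpace.mp (hbounded.of_isClosed_subset hclosed fun A hA i j => ?_)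
  exact mem_closedBall_zero_iff.mpr (State.norm_apply_le_one ⟨A, hA⟩ i j)

instance State.instSecondCountableTopology : SecondCountableTopology (State ι) :=
  haveI : SecondCountableTopology (Matrix ι ι ℂ) :=
    inferInstanceAs (SecondCountableTopology (ι → ι → ℂ))
  TopologicalSpace.Subtype.secondCountableTopology _

theorem averageTensorPow_eq_mixture (n : ℕ) (ν : MeasureTheory.Measure (State ι))
    [MeasureTheory.IsProbabilityMeasure ν] :
    ∃ (p : Fin (2 * (n + 1) ^ Fintype.card ι ^ 2 + 1) → ℝ) (hp : ∀ i, 0 ≤ p i)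
      (hp1 : ∑ i, p i = 1) (ρ : Fin (2 * (n + 1) ^ Fintype.card ι ^ 2 + 1) → State ι),
      (∀ i, ρ i ∈ ν.support) ∧
        averageTensorPow n ν = mixture p hp hp1 fun i => (ρ i).tensorPow n := by
  classical
  -- All exponent vectors `c` are allowed, not only those of total degree `n`; this keeps the
  -- dimension count simple.
  let F : State ι → (ι × ι → Fin (n + 1)) → ℂ := fun ρ c => ∏ a, ρ.1 a.1 a.2 ^ (c a : ℕ)
  have hF : ∀ ρ x y, (ρ.tensorPow n).1 x y = F ρ (typeCount fun k => (x k, y k)) := fun ρ x y =>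
    prod_comp_eq_prod_pow_typeCount (fun a : ι × ι => ρ.1 a.1 a.2) fun k => (x k, y k)
  have hcont : Continuous F := by
    refine continuous_pi fun c => continuous_finsetProd _ fun a _ => Continuous.pow ?_ _
    exact continuous_subtype_val.matrix_elem _ _
  have hFint : MeasureTheory.Integrable F ν := by
    refine MeasureTheory.Integrable.of_bound hcont.measurable.aestronglyMeasurable 1
      (Filter.Eventually.of_forall fun ρ => (pi_norm_le_iff_of_nonneg zero_le_one).mpr fun c => ?_)
    rw [norm_prod]
    refine Finset.prod_le_one (fun _ _ => norm_nonneg _) fun a _ => ?_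
    rw [norm_pow]
    exact pow_le_one₀ (norm_nonneg _) (ρ.norm_apply_le_one _ _)
  -- Closedness of the hull puts the integral in the hull itself, not just in its closure.
  have hcompact : IsCompact (convexHull ℝ (F '' ν.support)) :=
    isCompact_convexHull_of_isCompact
      ((MeasureTheory.Measure.isClosed_support.isCompact).image hcont)
  have hmem : ∫ ρ, F ρ ∂ν ∈ convexHull ℝ (F '' ν.support) := by
    refine (convex_convexHull ℝ _).integral_mem hcompact.isClosed ?_ hFint
    filter_upwards [MeasureTheory.Measure.support_mem_ae] with ρ hρ
    exact subset_convexHull ℝ _ ⟨ρ, hρ, rfl⟩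
  -- The factor 2 is the real dimension of `ℂ`.
  have hrank : Module.finrank ℝ ((ι × ι → Fin (n + 1)) → ℂ) = 2 * (n + 1) ^ Fintype.card ι ^ 2 := by
    rw [Module.finrank_pi_fintype]
    simp [Complex.finrank_real_complex, sq, mul_comm]
  have hcar := exists_stdSimplex_sum_of_mem_convexHull hmem
  rw [hrank] at hcar
  obtain ⟨p, hp, z, hz, hsum⟩ := hcar
  choose ρ hρ hρz using hz
  refine ⟨p, hp.1, hp.2, ρ, hρ, Subtype.ext (Matrix.ext fun x y => ?_)⟩
  have happ : ∀ c, ∫ ρ, F ρ c ∂ν = ∑ i, (p i : ℂ) * F (ρ i) c := fun c => by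
    rw [← MeasureTheory.eval_integral fun c => hFint.eval c, ← hsum]
    simp [hρz]
  change ∫ ρ, (ρ.tensorPow n).1 x y ∂ν = (∑ i, (p i : ℂ) • ((ρ i).tensorPow n).1) x y
  simp only [hF, happ, Matrix.sum_apply, Matrix.smul_apply, smul_eq_mul]

end Averages

/-- Along two polynomials, a polynomial in two variables is dominated by one polynomial, uniformly
over the box below them. -/
theorem exists_polynomial_eval_le (P : MvPolynomial (Fin 2) ℝ) (A B : Polynomial ℝ) :
    ∃ Q : Polynomial ℝ, ∀ t a b : ℝ, 0 ≤ a → a ≤ A.eval t → 0 ≤ b → b ≤ B.eval t →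
      0 < Q.eval t ∧ MvPolynomial.eval ![a, b] P ≤ Q.eval t := by
  -- Absolute values of coefficients make the sum dominate `P` and be monotone for nonnegative
  -- arguments; the summand 1 gives strict positivity.
  refine ⟨1 + ∑ m ∈ P.support, Polynomial.C |P.coeff m| * (A ^ m 0 * B ^ m 1),
    fun t a b ha haA hb hbB => ?_⟩
  have hle : MvPolynomial.eval ![a, b] P
      ≤ ∑ m ∈ P.support, |P.coeff m| * (A.eval t ^ m 0 * B.eval t ^ m 1) := by
    rw [MvPolynomial.eval_eq']
    refine Finset.sum_le_sum fun m _ => ?_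
    rw [Fin.prod_univ_two]
    simp only [Matrix.cons_val_zero, Matrix.cons_val_one]
    have hm : a ^ m 0 * b ^ m 1 ≤ A.eval t ^ m 0 * B.eval t ^ m 1 := by
      have := ha.trans haA
      gcongr
    calc P.coeff m * (a ^ m 0 * b ^ m 1) ≤ |P.coeff m| * (a ^ m 0 * b ^ m 1) := by
          gcongr
          exact le_abs_self _
      _ ≤ _ := by gcongr
  have hnonneg : 0 ≤ ∑ m ∈ P.support, |P.coeff m| * (A.eval t ^ m 0 * B.eval t ^ m 1) := by
    have h1 := ha.trans haA
    have h2 := hb.trans hbB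
    positivity
  simp only [Polynomial.eval_add, Polynomial.eval_one, Polynomial.eval_finsetSum,
    Polynomial.eval_mul, Polynomial.eval_C, Polynomial.eval_pow]
  exact ⟨by linarith, by linarith⟩

end Quantum

theorem mainTheorem6 (D : Quantum.Divergence.{u}) (d : ℕ) (hD : D.WeaklyQuasiConcave d) :
    ∃ Q : Polynomial ℝ, (∀ n : ℕ, 1 ≤ n → 0 < Q.eval (n : ℝ)) ∧
      ∀ (ι : Type u) [Fintype ι], Fintype.card ι = d →
        ∀ n : ℕ, 1 ≤ n →
        ∀ (ν : MeasureTheory.Measure (Quantum.State ι)) [MeasureTheory.IsProbabilityMeasure ν]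
          (σ : Quantum.State (Fin n → ι)), σ.IsPermSymmetric →
          (⨅ ρ ∈ ν.support, D.val (ρ.tensorPow n) σ) -
              ((Real.log (Q.eval (n : ℝ)) : ℝ) : EReal)
            ≤ D.val (Quantum.averageTensorPow n ν) σ := by
  classical
  obtain ⟨P, hP⟩ := hD
  obtain ⟨Q, hQ⟩ := Quantum.exists_polynomial_eval_le P
    (2 * (Polynomial.X + 1) ^ d ^ 2 + 1) ((Polynomial.X + 1) ^ d ^ 2)
  -- Taking `a = b = 0` extracts the positivity of `Q` alone.
  refine ⟨Q, fun n _ => (hQ n 0 0 le_rfl ?_ le_rfl ?_).1, fun ι _ hι n hn ν _ σ hσ => ?_⟩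
  · simp only [Polynomial.eval_add, Polynomial.eval_mul, Polynomial.eval_pow, Polynomial.eval_X,
      Polynomial.eval_one, Polynomial.eval_ofNat]
    positivity
  · simp only [Polynomial.eval_add, Polynomial.eval_pow, Polynomial.eval_X, Polynomial.eval_one]
    positivity
  obtain ⟨p, hp, hp1, ρ, hρ, havg⟩ := Quantum.averageTensorPow_eq_mixture n ν
  obtain ⟨hpos, hmix⟩ := hP ι hι n hn _ p hp hp1 (fun i => (ρ i).tensorPow n) σ
  rw [havg]
  refine le_trans (EReal.sub_le_sub (le_iInf fun i => iInf₂_le (ρ i) (hρ i)) ?_) hmix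
  refine EReal.coe_le_coe_iff.mpr (Real.log_le_log hpos (hQ n _ _ (Nat.cast_nonneg _) ?_
    (Nat.cast_nonneg _) ?_).2)
  · simp [hι]
  · have h := hσ.specCard_le
    rw [hι] at h
    simp only [Polynomial.eval_add, Polynomial.eval_pow, Polynomial.eval_X, Polynomial.eval_one]
    exact_mod_cast h
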